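/- Let $g\ge 1$, let $K$ be a field of characteristic $2$ with algebraic closure $\overline K$, let $q=\sum_{i=0}^{g+1}b_ix^i\in K[x]$ be monic and non-constant of degree at most $g+1$, and let $p=\sum_{i=0}^{2g+2}a_ix^i\in K[x]$ have degree at most $2g+2$, with $$2g+1\le\max\{2\deg q,\deg p\}\le 2g+2 .$$ We say that the equation $y^2+q(x)y=p(x)$ defines a curve of genus $g$ if $y^2+q(x)y-p(x)$ is irreducible over $\overline K(x)$ and the smooth projective curve over $\overline K$ with function field $\overline K(x)[y]/(y^2+q(x)y-p(x))$ has genus $g$. Then: 1. The equation $y^2+q(x)y=p(x)$ defines a curve of genus $g$ if and only if $$\gcd\bigl(q,\;p'^2+q'^2p\bigr)=1\qquad\text{and}\qquad \bigl(\deg q=g+1\ \text{ or }\ a_{2g+1}^2\ne a_{2g+2}\,b_g^2\bigr).$$ 2. The affine plane curve $y^2+q(x)y=p(x)$ is smooth at all of its $\overline K$-points if and only if $\gcd(q,\,p'^2+q'^2p)=1$. 3. The points at infinity, that is, the $\overline K$-points with $u=0$ of the curve $v^2+u^{g+1}q(1/u)\,v=u^{2g+2}p(1/u)$ obtained by $(u,v)=(1/x,\,y/x^{g+1})$,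 are all smooth if and only if $\deg q=g+1$ or $a_{2g+1}^2\ne a_{2g+2}\,b_g^2$. -/

import Mathlib

open Polynomial

noncomputable section

/-- The plane affine equation `y ^ 2 + q(x) y - p(x)`, where `x` is the variable `X 0` and
`y` is the variable `X 1`. -/
def hyperellipticEquation {K : Type*} [Field K] (q p : K[X]) : MvPolynomial (Fin 2) K :=
  MvPolynomial.X 1 ^ 2 + aeval (MvPolynomial.X 0 : MvPolynomial (Fin 2) K) q * MvPolynomial.X 1
    - aeval (MvPolynomial.X 0 : MvPolynomial (Fin 2) K) p

/-- The equation in the chart `(u, v) = (1 / x, y / x ^ (g + 1))`, that is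
`v ^ 2 + (u ^ (g + 1) q(1 / u)) v - u ^ (2 g + 2) p(1 / u)`. -/
def hyperellipticEquationAtInfinity {K : Type*} [Field K] (g : ℕ) (q p : K[X]) :
    MvPolynomial (Fin 2) K :=
  hyperellipticEquation (q.reflect (g + 1)) (p.reflect (2 * g + 2))

/-- The Jacobian criterion: some partial derivative of `f` does not vanish at the geometric
point `P`. -/
def IsSmoothAt {K : Type*} [Field K] (f : MvPolynomial (Fin 2) K)
    (P : Fin 2 → AlgebraicClosure K) : Prop :=
  ∃ i, MvPolynomial.aeval P (MvPolynomial.pderiv i f) ≠ 0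

/-- All geometric points of the affine curve `y ^ 2 + q(x) y = p(x)` are smooth. -/
def IsSmoothAffine {K : Type*} [Field K] (q p : K[X]) : Prop :=
  ∀ P : Fin 2 → AlgebraicClosure K,
    MvPolynomial.aeval P (hyperellipticEquation q p) = 0 →
      IsSmoothAt (hyperellipticEquation q p) P

/-- All geometric points at infinity (those with `u = 0` in the chart
`(u, v) = (1 / x, y / x ^ (g + 1))`) are smooth. -/
def IsSmoothAtInfinity {K : Type*} [Field K] (g : ℕ) (q p : K[X]) : Prop :=
  ∀ P : Fin 2 → AlgebraicClosure K, P 0 = 0 →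
    MvPolynomial.aeval P (hyperellipticEquationAtInfinity g q p) = 0 →
      IsSmoothAt (hyperellipticEquationAtInfinity g q p) P

section Genus

variable (k F : Type*) [Field k] [CommRing F] [Algebra k F] [Algebra (RatFunc k) F]
  [IsScalarTower k (RatFunc k) F]

/-- The elements of `F` that are integral over the subring `S` of `k(x)`. -/
def integralOver (S : Subalgebra k (RatFunc k)) : Submodule k F :=
  Subalgebra.toSubmodule ((integralClosure S F).restrictScalars k)

/-- The functions on the smooth projective model `C` of `F` that are regular where `x ≠ ∞`. -/
def regularAwayFromInfinity : Submodule k F :=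
  integralOver k F (Algebra.adjoin k {(RatFunc.X : RatFunc k)})

/-- The functions on `C` that are regular where `x ≠ 0`. -/
def regularAwayFromZero : Submodule k F :=
  integralOver k F (Algebra.adjoin k {(RatFunc.X : RatFunc k)⁻¹})

/-- The functions on `C` that are regular where `x ≠ 0, ∞`. -/
def regularAwayFromZeroAndInfinity : Submodule k F :=
  integralOver k F (Algebra.adjoin k {(RatFunc.X : RatFunc k), (RatFunc.X : RatFunc k)⁻¹})

/-- The genus of a finite separable extension `F` of `k(x)`, for `k` algebraically closed.
The smooth projective curve `C` with function field `F` is the normalization of the projective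
line in `F`. It is covered by the affine open sets `x ≠ ∞` and `x ≠ 0`, and its genus is the
dimension of `H¹(C, O_C)`, the cokernel of the Čech complex of this covering. -/
def functionFieldGenus : ℕ :=
  Module.finrank k
    (regularAwayFromZeroAndInfinity k F ⧸
      (regularAwayFromInfinity k F ⊔ regularAwayFromZero k F).submoduleOf
        (regularAwayFromZeroAndInfinity k F))

end Genus

/-- The polynomial `T ^ 2 + q(x) T - p(x)` over `k(x)`, with `k` the algebraic closure
of `K`. -/
def genericFibrePolynomial {K : Type*} [Field K] (q p : K[X]) :
    (RatFunc (AlgebraicClosure K))[X] :=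
  X ^ 2
    + C (algebraMap (AlgebraicClosure K)[X] (RatFunc (AlgebraicClosure K))
        (q.map (algebraMap K (AlgebraicClosure K)))) * X
    - C (algebraMap (AlgebraicClosure K)[X] (RatFunc (AlgebraicClosure K))
        (p.map (algebraMap K (AlgebraicClosure K))))

/-- `y ^ 2 + q(x) y = p(x)` defines a curve of genus `g`: it is geometrically irreducible, and
over the algebraic closure `k` of `K` the smooth projective curve with function field
`k(x)[T] / (T ^ 2 + q(x) T - p(x))` has genus `g`. -/
def DefinesCurveOfGenus {K : Type*} [Field K] (g : ℕ) (q p : K[X]) : Prop :=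
  Irreducible (genericFibrePolynomial q p) ∧
    functionFieldGenus (AlgebraicClosure K) (AdjoinRoot (genericFibrePolynomial q p)) = g

end

/-!
Let `k` be the algebraic closure of `K`, `Q` and `P` the images of `q` and `p`, and `F` the
quadratic extension of `k(x)` generated by a root `w` of `T ^ 2 + Q T - P`.

*Smoothness.* Over `x = a` the partial derivatives `q' y - p'` and `q` of the equation vanish
together at a point of the curve exactly when `q(a) = 0` and `(q' ^ 2 p + p' ^ 2)(a) = 0`, since
`y ^ 2 = p(a)` there and squaring is additive (`forall_isSmoothAt_iff`). In the chart at infinity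
this is applied to the reflected polynomials at `u = 0`.

*Arithmetic genus.* As long as `deg Q ≤ n + 1` and `deg P ≤ 2 n + 2`, the functions `x ^ i w`
with `i ≥ 0` are regular away from `∞` and those with `i ≤ -(n + 1)` are regular away from `0`,
so the `n` remaining ones span the image of `k[x, 1/x] ⊕ k[x, 1/x] w` in the cokernel of the Čech
complex. This image is everything, because a function regular away from `0` and `∞` differs from
an element of that module by a function regular away from `∞` (`exists_isIntegral_add`). Hence the
genus is at most `n` (`functionFieldGenus_le`).

*Nonsingular equations.* If `(s + b w) / (x - c)` is integral, with `s` and `b` polynomials not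
both vanishing at `c`, then its trace and norm being polynomials forces `s / b` to be the ordinate
of a singular point over `c` (`eval_eq_zero_of_nonsingular`). So without singular points the
regular functions on the two charts are `k[x] ⊕ k[x] w` and
`k[1/x] ⊕ k[1/x] w / x ^ (n + 1)`, the `n` functions above are independent in the cokernel, and the
genus is `n` (`functionFieldGenus_eq`). A root of the equation in `k(x)` would make it singular at
the zeros of `Q`, so the equation is also irreducible (`irreducible_of_nonsingular`).

*Singular equations.* At a singular point `(c, s)` the generator `(w + s) / (x - c)`, and at a
singular point at infinity the generator `w + s x ^ (g + 1)`, satisfies an equation within the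
degree bounds for `n = g - 1`, so the genus is less than `g`
(`functionFieldGenus_le_of_singular`, `functionFieldGenus_le_of_singular_infinity`).
-/

/-! ### Smoothness of the plane models -/

section Smoothness

variable {K : Type*} [Field K]

theorem aeval_hyperellipticEquation (q p : K[X]) (P : Fin 2 → AlgebraicClosure K) :
    MvPolynomial.aeval P (hyperellipticEquation q p) =
      P 1 ^ 2 + aeval (P 0) q * P 1 - aeval (P 0) p := by
  simp [hyperellipticEquation, ← Polynomial.aeval_algHom_apply]

theorem aeval_pderiv_zero_hyperellipticEquation (q p : K[X]) (P : Fin 2 → AlgebraicClosure K) :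
    MvPolynomial.aeval P (MvPolynomial.pderiv 0 (hyperellipticEquation q p)) =
      aeval (P 0) (derivative q) * P 1 - aeval (P 0) (derivative p) := by
  simp [hyperellipticEquation, Derivation.map_aeval, ← Polynomial.aeval_algHom_apply,
    MvPolynomial.pderiv_X, mul_comm]

theorem aeval_pderiv_one_hyperellipticEquation [CharP K 2] (q p : K[X])
    (P : Fin 2 → AlgebraicClosure K) :
    MvPolynomial.aeval P (MvPolynomial.pderiv 1 (hyperellipticEquation q p)) =
      aeval (P 0) q := by
  have : CharP (AlgebraicClosure K) 2 := charP_of_injective_algebraMap' K 2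
  have h2 : (2 : AlgebraicClosure K) = 0 := CharTwo.two_eq_zero
  simp [hyperellipticEquation, Derivation.map_aeval, ← Polynomial.aeval_algHom_apply,
    MvPolynomial.pderiv_X, h2]

/-- A point of `y ^ 2 + q y = p` over `x = a` is singular exactly when `q` and
`p' ^ 2 + q' ^ 2 p` both vanish at `a`: for `q(a) = 0` the only point over `a` has
`y = √p(a)`, and `(q' y + p') ^ 2 = q' ^ 2 p + p' ^ 2` there. -/
theorem forall_isSmoothAt_iff [CharP K 2] (q p : K[X]) (a : AlgebraicClosure K) :
    (∀ P : Fin 2 → AlgebraicClosure K, P 0 = a →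
      MvPolynomial.aeval P (hyperellipticEquation q p) = 0 →
        IsSmoothAt (hyperellipticEquation q p) P) ↔
      aeval a q ≠ 0 ∨ aeval a (derivative p ^ 2 + derivative q ^ 2 * p) ≠ 0 := by
  have : CharP (AlgebraicClosure K) 2 := charP_of_injective_algebraMap' K 2
  have key : ∀ b : AlgebraicClosure K, b ^ 2 = aeval a p →
      aeval a (derivative p ^ 2 + derivative q ^ 2 * p) =
        (aeval a (derivative q) * b - aeval a (derivative p)) ^ 2 := by
    intro b hb
    rw [map_add, map_mul, map_pow, map_pow, ← hb, CharTwo.sub_eq_add, CharTwo.add_sq]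
    ring
  constructor
  · intro h
    by_contra! hc
    obtain ⟨b, hb⟩ := IsAlgClosed.exists_pow_nat_eq (aeval a p) two_pos
    obtain ⟨i, hi⟩ := h ![a, b] rfl (by
      simp [aeval_hyperellipticEquation, hc.1, hb])
    fin_cases i
    · apply hi
      have := hc.2
      rw [key b hb] at this
      simpa [aeval_pderiv_zero_hyperellipticEquation] using this
    · apply hi
      simpa [aeval_pderiv_one_hyperellipticEquation] using hc.1
  · rintro h P rfl hP
    by_cases hq : aeval (P 0) q = 0
    · refine ⟨0, ?_⟩
      have hb : P 1 ^ 2 = aeval (P 0) p := by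
        rw [aeval_hyperellipticEquation, hq] at hP
        linear_combination hP
      have := h.resolve_left (not_not.mpr hq)
      rw [key _ hb] at this
      rw [aeval_pderiv_zero_hyperellipticEquation]
      exact fun h0 => this (by rw [h0]; simp)
    · exact ⟨1, by rwa [aeval_pderiv_one_hyperellipticEquation]⟩

theorem isSmoothAffine_iff [CharP K 2] (q p : K[X]) :
    IsSmoothAffine q p ↔ IsCoprime q (derivative p ^ 2 + derivative q ^ 2 * p) := by
  rw [isCoprime_iff_aeval_ne_zero_of_isAlgClosed K (AlgebraicClosure K)]
  simp_rw [← forall_isSmoothAt_iff]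
  exact ⟨fun h a P _ => h P, fun h P => h _ P rfl⟩

theorem coeff_zero_reflect (f : K[X]) (N : ℕ) : (f.reflect N).coeff 0 = f.coeff N := by
  simp [coeff_reflect]

theorem coeff_one_reflect (f : K[X]) (N : ℕ) : (f.reflect (N + 1)).coeff 1 = f.coeff N := by
  rw [coeff_reflect, revAt_le (by omega), Nat.add_sub_cancel]

/-- The criterion of `forall_isSmoothAt_iff` at `u = 0`, in terms of the leading coefficients. -/
theorem reflect_nonsingular_iff [CharP K 2] {g : ℕ} {q p : K[X]} (hq : q.Monic)
    (hq_deg : q.natDegree ≤ g + 1) :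
    ((q.reflect (g + 1)).coeff 0 ≠ 0 ∨
      (derivative (p.reflect (2 * g + 2)) ^ 2 +
        derivative (q.reflect (g + 1)) ^ 2 * p.reflect (2 * g + 2)).coeff 0 ≠ 0) ↔
      (q.natDegree = g + 1 ∨
        p.coeff (2 * g + 1) ^ 2 ≠ p.coeff (2 * g + 2) * q.coeff g ^ 2) := by
  refine or_congr ?_ (not_congr ?_)
  · rw [coeff_zero_reflect]
    constructor
    · exact fun h => le_antisymm hq_deg (le_natDegree_of_ne_zero h)
    · intro h
      rw [← h, hq.coeff_natDegree]
      exact one_ne_zero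
  · rw [coeff_add, mul_coeff_zero, pow_two, pow_two, mul_coeff_zero, mul_coeff_zero,
      coeff_derivative, coeff_derivative, coeff_zero_reflect,
      show 2 * g + 2 = (2 * g + 1) + 1 from rfl, coeff_one_reflect, coeff_one_reflect,
      CharTwo.add_eq_zero]
    simp only [Nat.cast_zero, zero_add, mul_one]
    rw [pow_two, pow_two, mul_comm (q.coeff g * q.coeff g)]

theorem isSmoothAtInfinity_iff [CharP K 2] {g : ℕ} {q p : K[X]} (hq : q.Monic)
    (hq_deg : q.natDegree ≤ g + 1) :
    IsSmoothAtInfinity g q p ↔ (q.natDegree = g + 1 ∨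
        p.coeff (2 * g + 1) ^ 2 ≠ p.coeff (2 * g + 2) * q.coeff g ^ 2) := by
  rw [← reflect_nonsingular_iff hq hq_deg, IsSmoothAtInfinity, hyperellipticEquationAtInfinity,
    forall_isSmoothAt_iff]
  simp only [← coeff_zero_eq_aeval_zero', ne_eq, map_eq_zero_iff _
    (algebraMap K (AlgebraicClosure K)).injective]

end Smoothness

/-! ### The rings `k[x]`, `k[1/x]` and `k[x, 1/x]` inside `k(x)` -/

section CoordinateRings

variable {k : Type*} [Field k]

theorem mem_adjoin_singleton_iff_exists_aeval {A : Type*} [CommRing A] [Algebra k A] {t r : A} :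
    r ∈ Algebra.adjoin k {t} ↔ ∃ p : k[X], aeval t p = r := by
  rw [Algebra.adjoin_singleton_eq_range_aeval]
  rfl

theorem aeval_mul_mem {A : Type*} [CommRing A] [Algebra k A] (M : Submodule k A) {t s : A}
    (h : ∀ i : ℕ, t ^ i * s ∈ M) (p : k[X]) : aeval t p * s ∈ M := by
  rw [aeval_eq_sum_range, Finset.sum_mul]
  refine M.sum_mem fun i _ => ?_
  rw [smul_mul_assoc]
  exact M.smul_mem _ (h i)

variable {E : Type*} [Field E] [Algebra k E]

theorem aeval_inv_reflect {x : E} (hx : x ≠ 0) {N : ℕ} {p : k[X]} (hp : p.natDegree ≤ N) :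
    aeval x⁻¹ (p.reflect N) = aeval x p / x ^ N := by
  let : Invertible x := invertibleOfNonzero hx
  rw [eq_div_iff (pow_ne_zero _ hx)]
  simpa [aeval_def] using eval₂_reflect_mul_pow (algebraMap k E) x N p hp

/-- The field `E` is the field of rational functions in `t`: every element is a quotient of
polynomials in `t`, and `t` is transcendental over `k`. -/
structure IsRationalCoordinate (k : Type*) {E : Type*} [Field k] [Field E] [Algebra k E]
    (t : E) : Prop where
  transcendental : Transcendental k t
  exists_div : ∀ r : E, ∃ p q : k[X], aeval t p / aeval t q = r

namespace IsRationalCoordinate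

variable {t : E}

theorem aeval_injective (h : IsRationalCoordinate k t) :
    Function.Injective (aeval t : k[X] → E) :=
  transcendental_iff_injective.mp h.transcendental

theorem ne_zero (h : IsRationalCoordinate k t) : t ≠ 0 := by
  rintro rfl
  exact h.transcendental isAlgebraic_zero

theorem inv (h : IsRationalCoordinate k t) : IsRationalCoordinate k t⁻¹ where
  transcendental := fun ha => h.transcendental (IsAlgebraic.inv_iff.mp ha)
  exists_div r := by
    obtain ⟨p, q, rfl⟩ := h.exists_div r
    refine ⟨p.reflect (max p.natDegree q.natDegree), q.reflect (max p.natDegree q.natDegree), ?_⟩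
    rw [aeval_inv_reflect h.ne_zero (le_max_left _ _),
      aeval_inv_reflect h.ne_zero (le_max_right _ _),
      div_div_div_cancel_right₀ (pow_ne_zero _ h.ne_zero)]

/-- `k[t]` is integrally closed in `k(t)`. -/
theorem mem_adjoin_of_isIntegral (h : IsRationalCoordinate k t) {r : E}
    (hr : IsIntegral (Algebra.adjoin k {t}) r) : r ∈ Algebra.adjoin k {t} := by
  let : Algebra k[X] E := (aeval t : k[X] →ₐ[k] E).toRingHom.toAlgebra
  have : FaithfulSMul k[X] E :=
    (faithfulSMul_iff_algebraMap_injective k[X] E).mpr h.aeval_injective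
  have : IsFractionRing k[X] E := IsFractionRing.of_field _ _ fun r => by
    obtain ⟨p, q, hpq⟩ := h.exists_div r
    exact ⟨p, q, hpq.symm⟩
  let f : k[X] →+* Algebra.adjoin k {t} :=
    ((aeval t : k[X] →ₐ[k] E).codRestrict (Algebra.adjoin k {t})
      fun p => mem_adjoin_singleton_iff_exists_aeval.mpr ⟨p, rfl⟩).toRingHom
  have hf : Function.Surjective f := by
    rintro ⟨r, hr⟩
    obtain ⟨p, rfl⟩ := mem_adjoin_singleton_iff_exists_aeval.mp hr
    exact ⟨p, rfl⟩
  obtain ⟨p, hp, hp0⟩ := hr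
  obtain ⟨p', hp', -, hm⟩ := lifts_and_natDegree_eq_and_monic
    ((lifts_iff_coeff_lifts p).mpr fun n => hf (p.coeff n)) hp
  have hint : IsIntegral k[X] r := by
    refine ⟨p', hm, ?_⟩
    rw [← hp', eval₂_map] at hp0
    exact hp0
  obtain ⟨s, hs⟩ := IsIntegrallyClosed.isIntegral_iff.mp hint
  exact mem_adjoin_singleton_iff_exists_aeval.mpr ⟨s, hs⟩

end IsRationalCoordinate

theorem isRationalCoordinate_ratFuncX : IsRationalCoordinate k (RatFunc.X : RatFunc k) where
  transcendental := RatFunc.transcendental_X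
  exists_div r := by
    obtain ⟨p, q, -, hpq⟩ := IsFractionRing.div_surjective (A := k[X]) r
    exact ⟨p, q, by rw [RatFunc.aeval_X_left_eq_algebraMap, RatFunc.aeval_X_left_eq_algebraMap,
      hpq]⟩

theorem pow_mem_adjoin_singleton (x : E) (n : ℕ) : x ^ n ∈ Algebra.adjoin k {x} :=
  pow_mem (Algebra.self_mem_adjoin_singleton k x) n

theorem adjoin_singleton_le_pair (x : E) : Algebra.adjoin k {x} ≤ Algebra.adjoin k {x, x⁻¹} :=
  Algebra.adjoin_mono (by simp)

theorem adjoin_inv_le_pair (x : E) : Algebra.adjoin k {x⁻¹} ≤ Algebra.adjoin k {x, x⁻¹} :=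
  Algebra.adjoin_mono (by simp)

theorem zpow_mem_adjoin_pair (x : E) (i : ℤ) : x ^ i ∈ Algebra.adjoin k {x, x⁻¹} := by
  obtain ⟨n, rfl | rfl⟩ := i.eq_nat_or_neg
  · rw [zpow_natCast]
    exact pow_mem (Algebra.subset_adjoin (by simp)) n
  · rw [zpow_neg, zpow_natCast, ← inv_pow]
    exact pow_mem (Algebra.subset_adjoin (by simp)) n

/-- Every Laurent polynomial in `x` is a polynomial up to a power of `x`. -/
theorem exists_pow_mul_mem_adjoin {x : E} (hx : x ≠ 0) {r : E}
    (hr : r ∈ Algebra.adjoin k {x, x⁻¹}) :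
    ∃ N : ℕ, ∀ M, N ≤ M → x ^ M * r ∈ Algebra.adjoin k {x} := by
  suffices h : ∃ N : ℕ, x ^ N * r ∈ Algebra.adjoin k {x} by
    obtain ⟨N, hN⟩ := h
    refine ⟨N, fun M hM => ?_⟩
    obtain ⟨j, rfl⟩ := Nat.exists_eq_add_of_le' hM
    rw [pow_add, mul_assoc]
    exact mul_mem (pow_mem_adjoin_singleton x j) hN
  induction hr using Algebra.adjoin_induction with
  | mem y hy =>
    rw [Set.mem_insert_iff, Set.mem_singleton_iff] at hy
    rcases hy with hy | hy
    · exact ⟨0, by rw [pow_zero, one_mul, hy]; exact Algebra.self_mem_adjoin_singleton k x⟩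
    · exact ⟨1, by rw [pow_one, hy, mul_inv_cancel₀ hx]; exact one_mem _⟩
  | algebraMap c => exact ⟨0, by rw [pow_zero, one_mul]; exact algebraMap_mem _ c⟩
  | add a b _ _ ha hb =>
    obtain ⟨m, hm⟩ := ha
    obtain ⟨n, hn⟩ := hb
    refine ⟨m + n, ?_⟩
    rw [show x ^ (m + n) * (a + b) = x ^ n * (x ^ m * a) + x ^ m * (x ^ n * b) by ring]
    exact add_mem (mul_mem (pow_mem_adjoin_singleton x n) hm)
      (mul_mem (pow_mem_adjoin_singleton x m) hn)
  | mul a b _ _ ha hb =>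
    obtain ⟨m, hm⟩ := ha
    obtain ⟨n, hn⟩ := hb
    refine ⟨m + n, ?_⟩
    rw [show x ^ (m + n) * (a * b) = (x ^ m * a) * (x ^ n * b) by ring]
    exact mul_mem hm hn

theorem exists_inv_pow_mul_mem_adjoin {x : E} (hx : x ≠ 0) {r : E}
    (hr : r ∈ Algebra.adjoin k {x, x⁻¹}) :
    ∃ N : ℕ, ∀ M, N ≤ M → x⁻¹ ^ M * r ∈ Algebra.adjoin k {x⁻¹} := by
  refine exists_pow_mul_mem_adjoin (inv_ne_zero hx) ?_
  rwa [inv_inv, Set.pair_comm]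

theorem mem_adjoin_pair_of_pow_mul_mem {x : E} (hx : x ≠ 0) {r : E} {N : ℕ}
    (h : x ^ N * r ∈ Algebra.adjoin k {x}) : r ∈ Algebra.adjoin k {x, x⁻¹} := by
  have h' := mul_mem (zpow_mem_adjoin_pair (k := k) x (-N)) (adjoin_singleton_le_pair x h)
  rwa [zpow_neg, zpow_natCast, inv_mul_cancel_left₀ (pow_ne_zero _ hx)] at h'

theorem mem_of_forall_zpow_mem {x : E} (hx : x ≠ 0) {M : Submodule k E}
    (h : ∀ i : ℤ, x ^ i ∈ M) {r : E} (hr : r ∈ Algebra.adjoin k {x, x⁻¹}) : r ∈ M := by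
  obtain ⟨N, hN⟩ := exists_pow_mul_mem_adjoin hx hr
  obtain ⟨p, hp⟩ := mem_adjoin_singleton_iff_exists_aeval.mp (hN N le_rfl)
  have hr' : r = aeval x p * x ^ (-N : ℤ) := by
    rw [hp, zpow_neg, zpow_natCast, mul_right_comm, mul_inv_cancel₀ (pow_ne_zero _ hx), one_mul]
  rw [hr']
  refine aeval_mul_mem M (fun i => ?_) p
  rw [← zpow_natCast, ← zpow_add₀ hx]
  exact h _

/-- Let `C` be the localization `S[1/x]` of a subring `S` of a field. If `S` is integrally closed
in the field, then so is `C`. -/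
theorem Subalgebra.mem_of_isIntegral_of_forall_exists_pow_mul_mem {S C : Subalgebra k E}
    (hSC : S ≤ C) {x : E} (hx : x ≠ 0) (hxS : x ∈ S) (hxC : x⁻¹ ∈ C)
    (hclear : ∀ r ∈ C, ∃ N : ℕ, x ^ N * r ∈ S) (hS : ∀ r : E, IsIntegral S r → r ∈ S) {r : E}
    (hr : IsIntegral C r) : r ∈ C := by
  let : Algebra S C := (Subalgebra.inclusion hSC).toRingHom.toAlgebra
  have : IsScalarTower S C E := IsScalarTower.of_algebraMap_eq fun _ => rfl
  let y : S := ⟨x, hxS⟩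
  have hloc : IsLocalization (Submonoid.powers y) C := by
    rw [isLocalization_iff]
    refine ⟨?_, ?_, ?_⟩
    · rintro ⟨_, n, rfl⟩
      rw [map_pow]
      exact IsUnit.pow n (.of_mul_eq_one ⟨x⁻¹, hxC⟩ (Subtype.ext (mul_inv_cancel₀ hx)))
    · rintro ⟨z, hz⟩
      obtain ⟨N, hN⟩ := hclear z hz
      exact ⟨(⟨_, hN⟩, ⟨y ^ N, N, rfl⟩), Subtype.ext (mul_comm z _)⟩
    · intro a b hab
      exact ⟨1, congrArg _ (Subalgebra.inclusion_injective hSC hab)⟩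
  obtain ⟨⟨_, n, rfl⟩, hm⟩ :=
    IsIntegral.exists_multiple_integral_of_isLocalization (Submonoid.powers y) r hr
  have h : x ^ n * r ∈ C := hSC (hS _ hm)
  have h' := mul_mem (pow_mem hxC n) h
  rwa [inv_pow, inv_mul_cancel_left₀ (pow_ne_zero _ hx)] at h'

theorem IsRationalCoordinate.mem_adjoin_pair_of_isIntegral {x : E}
    (h : IsRationalCoordinate k x) {r : E}
    (hr : IsIntegral (Algebra.adjoin k {x, x⁻¹}) r) : r ∈ Algebra.adjoin k {x, x⁻¹} :=
  Subalgebra.mem_of_isIntegral_of_forall_exists_pow_mul_mem (adjoin_singleton_le_pair x) h.ne_zero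
    (Algebra.self_mem_adjoin_singleton k x) (Algebra.subset_adjoin (by simp))
    (fun _ hr => (exists_pow_mul_mem_adjoin h.ne_zero hr).imp fun N hN => hN N le_rfl)
    (fun _ => h.mem_adjoin_of_isIntegral) hr

theorem linearIndependent_zpow {x : E} (hx : Transcendental k x) :
    LinearIndependent k (fun i : ℤ => x ^ i) := by
  have hx0 : x ≠ 0 := by
    rintro rfl
    exact hx isAlgebraic_zero
  rw [linearIndependent_iff']
  intro s c hc i hi
  obtain ⟨N, hN⟩ : ∃ N : ℕ, ∀ j ∈ s, 0 ≤ j + N := by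
    refine ⟨∑ j ∈ s, j.natAbs, fun j hj => ?_⟩
    have := Finset.single_le_sum (f := fun j : ℤ => j.natAbs) (fun _ _ => Nat.zero_le _) hj
    omega
  have hp : ∑ j ∈ s, monomial (j + N).toNat (c j) = 0 := by
    apply transcendental_iff_injective.mp hx
    rw [map_sum, map_zero, ← mul_zero (x ^ N), ← hc, Finset.mul_sum]
    refine Finset.sum_congr rfl fun j hj => ?_
    rw [aeval_monomial, Algebra.smul_def, mul_left_comm, ← zpow_natCast, ← zpow_natCast,
      ← zpow_add₀ hx0, Int.toNat_of_nonneg (hN j hj), add_comm]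
  have hco := congrArg (fun p => p.coeff (i + N).toNat) hp
  simp only [finsetSum_coeff, coeff_monomial, coeff_zero] at hco
  rw [Finset.sum_eq_single_of_mem i hi, if_pos rfl] at hco
  · exact hco
  · intro j hj hji
    refine if_neg fun h => hji ?_
    have h1 := hN j hj
    have h2 := hN i hi
    omega

theorem adjoin_singleton_le_span {x r : E} (hr : r ∈ Algebra.adjoin k {x}) :
    r ∈ Submodule.span k ((fun i : ℤ => x ^ i) '' {i | 0 ≤ i}) := by
  obtain ⟨p, rfl⟩ := mem_adjoin_singleton_iff_exists_aeval.mp hr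
  rw [← mul_one (aeval x p)]
  refine aeval_mul_mem _ (fun i => Submodule.subset_span ?_) p
  exact ⟨i, by simp, by simp⟩

theorem zpow_mul_adjoin_inv_le_span {x r : E} (hx : x ≠ 0) (n : ℤ)
    (hr : r ∈ Algebra.adjoin k {x⁻¹}) :
    x ^ n * r ∈ Submodule.span k ((fun i : ℤ => x ^ i) '' {i | i ≤ n}) := by
  obtain ⟨p, rfl⟩ := mem_adjoin_singleton_iff_exists_aeval.mp hr
  rw [mul_comm]
  refine aeval_mul_mem _ (fun i => Submodule.subset_span ?_) p
  refine ⟨n - i, by simp, ?_⟩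
  dsimp only
  rw [sub_eq_neg_add, zpow_add₀ hx, zpow_neg, zpow_natCast, inv_pow]

end CoordinateRings

/-! ### Quadratic extensions in characteristic two -/

section QuadraticGenerator

variable {k E F : Type*} [Field k] [Field E] [CommRing F] [Algebra k E] [Algebra E F]

/-- `F` is the quadratic extension `E ⊕ E w` of `E` with `w ^ 2 + Q w = P`, and `w ↦ w + Q`
extends to an endomorphism of `F` over `E` (in characteristic two, the conjugation). -/
structure IsQuadraticGenerator (Q P : E) (w : F) : Prop where
  sq_add : w ^ 2 + algebraMap E F Q * w = algebraMap E F P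
  exists_repr : ∀ z : F, ∃ a b : E, z = algebraMap E F a + algebraMap E F b * w
  eq_zero : ∀ a b : E, algebraMap E F a + algebraMap E F b * w = 0 → b = 0
  exists_conj : ∃ σ : F →ₐ[E] F, σ w = w + algebraMap E F Q

namespace IsQuadraticGenerator

variable {Q P : E} {w : F}

theorem snd_eq (h : IsQuadraticGenerator Q P w) {a b c d : E}
    (hab : algebraMap E F a + algebraMap E F b * w = algebraMap E F c + algebraMap E F d * w) :
    b = d := by
  refine sub_eq_zero.mp (h.eq_zero (a - c) (b - d) ?_)
  rw [map_sub, map_sub]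
  linear_combination hab

/-- The generator `(w + r) / d`. -/
theorem add_div [CharP E 2] (h : IsQuadraticGenerator Q P w) (r : E) {d : E} (hd : d ≠ 0) :
    IsQuadraticGenerator (Q / d) ((P + r ^ 2 + r * Q) / d ^ 2)
      (algebraMap E F d⁻¹ * (w + algebraMap E F r)) where
  sq_add := by
    have h2 : algebraMap E F 2 = 0 := by rw [CharTwo.two_eq_zero, map_zero]
    rw [map_ofNat] at h2
    simp only [div_eq_mul_inv, map_mul, map_add, map_pow, ← inv_pow]
    linear_combination (algebraMap E F d⁻¹) ^ 2 * h.sq_add +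
      (algebraMap E F d⁻¹) ^ 2 * algebraMap E F r * w * h2
  exists_repr z := by
    obtain ⟨a, b, rfl⟩ := h.exists_repr z
    refine ⟨a - b * r, b * d, ?_⟩
    have hd' : algebraMap E F d * algebraMap E F d⁻¹ = 1 := by
      rw [← map_mul, mul_inv_cancel₀ hd, map_one]
    simp only [map_mul, map_sub]
    linear_combination (-(algebraMap E F b * (w + algebraMap E F r))) * hd'
  eq_zero a b hab := by
    have hb := h.eq_zero (a + b * d⁻¹ * r) (b * d⁻¹) (by
      simp only [map_mul, map_add]
      linear_combination hab)
    exact (mul_eq_zero.mp hb).resolve_right (inv_ne_zero hd)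
  exists_conj := by
    obtain ⟨σ, hσ⟩ := h.exists_conj
    refine ⟨σ, ?_⟩
    rw [map_mul, map_add, AlgHom.commutes, AlgHom.commutes, hσ, div_eq_mul_inv, map_mul]
    ring

/-- An element with integral trace and norm is integral. -/
theorem isIntegral_of_trace_mem_of_norm_mem [CharP E 2] (h : IsQuadraticGenerator Q P w)
    {S : Subalgebra k E} {a b : E} (htr : b * Q ∈ S) (hnorm : a ^ 2 + a * (b * Q) + b ^ 2 * P ∈ S) :
    IsIntegral S (algebraMap E F a + algebraMap E F b * w) := by
  have h2 : algebraMap E F 2 = 0 := by rw [CharTwo.two_eq_zero, map_zero]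
  rw [map_ofNat] at h2
  refine ⟨X ^ 2 + C (⟨b * Q, htr⟩ : S) * X - C ⟨_, hnorm⟩, by monicity!, ?_⟩
  have halg : ∀ (r : E) (hr : r ∈ S), algebraMap S F ⟨r, hr⟩ = algebraMap E F r :=
    fun _ _ => rfl
  simp only [eval₂_sub, eval₂_add, eval₂_mul, eval₂_pow, eval₂_X, eval₂_C, halg, map_add, map_mul,
    map_pow]
  linear_combination (algebraMap E F b) ^ 2 * h.sq_add + algebraMap E F a * algebraMap E F b * w * h2

/-- The trace and the norm of an integral element lie in the base ring, if that is integrally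
closed. -/
theorem trace_mem_and_norm_mem_of_isIntegral [CharP E 2] [Nontrivial F]
    (h : IsQuadraticGenerator Q P w)
    {S : Subalgebra k E} (hS : ∀ r : E, IsIntegral S r → r ∈ S) {a b : E}
    (hz : IsIntegral S (algebraMap E F a + algebraMap E F b * w)) :
    b * Q ∈ S ∧ a ^ 2 + a * (b * Q) + b ^ 2 * P ∈ S := by
  have h2 : algebraMap E F 2 = 0 := by rw [CharTwo.two_eq_zero, map_zero]
  rw [map_ofNat] at h2
  obtain ⟨σ, hσ⟩ := h.exists_conj
  have hz' := hz.map (σ.restrictScalars S)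
  have hσz : σ.restrictScalars S (algebraMap E F a + algebraMap E F b * w) =
      algebraMap E F a + algebraMap E F b * (w + algebraMap E F Q) := by
    rw [AlgHom.restrictScalars_apply, map_add, map_mul, AlgHom.commutes, AlgHom.commutes, hσ]
  rw [hσz] at hz'
  have hinj : Function.Injective (algebraMap E F) := (algebraMap E F).injective
  constructor
  · apply hS
    rw [← isIntegral_algebraMap_iff hinj, map_mul]
    convert hz'.sub hz using 1
    ring
  · apply hS
    rw [← isIntegral_algebraMap_iff hinj]
    convert hz.mul hz' using 1
    simp only [map_add, map_mul, map_pow]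
    linear_combination -(algebraMap E F b) ^ 2 * h.sq_add -
      algebraMap E F a * algebraMap E F b * w * h2

end IsQuadraticGenerator

/-- The trace `Q` of `w` is a common denominator for the coordinates of integral elements. -/
theorem mul_mem_of_norm_mem {S : Subalgebra k E} (hS : ∀ r : E, IsIntegral S r → r ∈ S)
    {Q P a b : E} (hQ : Q ∈ S) (hP : P ∈ S) (htr : b * Q ∈ S)
    (hnorm : a ^ 2 + a * (b * Q) + b ^ 2 * P ∈ S) : Q * a ∈ S := by
  apply hS
  have hc : -(Q ^ 2 * (a ^ 2 + a * (b * Q) + b ^ 2 * P)) + (b * Q) ^ 2 * P ∈ S :=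
    add_mem (neg_mem (mul_mem (pow_mem hQ 2) hnorm)) (mul_mem (pow_mem htr 2) hP)
  refine ⟨X ^ 2 + C (⟨b * Q * Q, mul_mem htr hQ⟩ : S) * X + C ⟨_, hc⟩, by monicity!, ?_⟩
  have halg : ∀ (r : E) (hr : r ∈ S), algebraMap S E ⟨r, hr⟩ = r := fun _ _ => rfl
  simp only [eval₂_add, eval₂_mul, eval₂_pow, eval₂_X, eval₂_C, halg]
  ring

end QuadraticGenerator

/-! ### Nonsingular equations define integrally closed rings -/

section Nonsingular

variable {k E : Type*} [Field k] [CharP k 2] [Field E] [Algebra k E]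

/-- The local computation at `x = c`: if `(s + b y) / (x - c)` is integral and the curve
`y ^ 2 + Q y = P` has no singular point over `c`, then `s` and `b` vanish at `c`. Otherwise
`s / b` is the value of `y` at a singular point: the norm of `s + b y` vanishes doubly at `c`. -/
theorem eval_eq_zero_of_nonsingular {Q P s b τ ν : k[X]} {c : k}
    (hc : Q.eval c ≠ 0 ∨ (derivative P ^ 2 + derivative Q ^ 2 * P).eval c ≠ 0)
    (htr : b * Q = (X - C c) * τ)
    (hnorm : s ^ 2 + s * (b * Q) + b ^ 2 * P = (X - C c) ^ 2 * ν) :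
    s.eval c = 0 ∧ b.eval c = 0 := by
  have h2 : (2 : k) = 0 := CharTwo.two_eq_zero
  have e1 := congrArg (eval c) htr
  have e2 := congrArg (eval c) hnorm
  have e3 := congrArg (fun f => eval c (derivative f)) hnorm
  simp only [eval_add, eval_mul, eval_pow, eval_sub, eval_X, eval_C, derivative_add,
    derivative_mul, derivative_pow, derivative_sub, derivative_X, derivative_C, sub_self,
    Nat.cast_ofNat, h2, pow_one, Nat.add_one_sub_one, zero_mul, mul_zero,
    zero_add, add_zero, ne_eq, OfNat.ofNat_ne_zero, not_false_eq_true, zero_pow, sub_zero,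
    mul_one] at e1 e2 e3 hc
  have hb : b.eval c = 0 := by
    rcases hc with hc | hc
    · exact (mul_eq_zero.mp e1).resolve_right hc
    · by_contra hb
      have hQ : Q.eval c = 0 := (mul_eq_zero.mp e1).resolve_left hb
      apply hc
      rw [hQ] at e2 e3
      have e4 : eval c s * eval c (derivative Q) + eval c b * eval c (derivative P) = 0 := by
        apply (mul_eq_zero.mp _).resolve_left hb
        linear_combination e3
      have e5 : eval c b ^ 2 * (eval c (derivative P) ^ 2 +
          eval c (derivative Q) ^ 2 * eval c P) = 0 := by
        linear_combination (eval c b * eval c (derivative P) - eval c s * eval c (derivative Q)) *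
          e4 + eval c (derivative Q) ^ 2 * e2
      exact (mul_eq_zero.mp e5).resolve_left (pow_ne_zero _ hb)
  refine ⟨?_, hb⟩
  rw [hb] at e2
  have : eval c s ^ 2 = 0 := by linear_combination e2
  exact pow_eq_zero_iff two_ne_zero |>.mp this

theorem mem_of_sub_mul_mem_of_nonsingular {t : E} (ht : IsRationalCoordinate k t) {Q P : k[X]}
    {c : k} (hc : Q.eval c ≠ 0 ∨ (derivative P ^ 2 + derivative Q ^ 2 * P).eval c ≠ 0) {a b : E}
    (htr : b * aeval t Q ∈ Algebra.adjoin k {t})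
    (hnorm : a ^ 2 + a * (b * aeval t Q) + b ^ 2 * aeval t P ∈ Algebra.adjoin k {t})
    (ha : aeval t (X - C c) * a ∈ Algebra.adjoin k {t})
    (hb : aeval t (X - C c) * b ∈ Algebra.adjoin k {t}) :
    a ∈ Algebra.adjoin k {t} ∧ b ∈ Algebra.adjoin k {t} := by
  simp only [mem_adjoin_singleton_iff_exists_aeval] at htr hnorm ha hb ⊢
  obtain ⟨τ, hτ⟩ := htr
  obtain ⟨ν, hν⟩ := hnorm
  obtain ⟨s, hs⟩ := ha
  obtain ⟨r, hr⟩ := hb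
  have hne : aeval t (X - C c) ≠ 0 := by
    rw [Ne, map_eq_zero_iff _ ht.aeval_injective]
    exact X_sub_C_ne_zero c
  obtain ⟨hs0, hr0⟩ := eval_eq_zero_of_nonsingular (s := s) (b := r) (τ := τ) (ν := ν) hc
    (ht.aeval_injective (by
      rw [map_mul, map_mul, hτ, hr]
      ring))
    (ht.aeval_injective (by
      rw [map_mul, map_add, map_add, map_pow, map_pow, map_mul, map_mul, map_mul, map_pow, hν, hr,
        hs]
      ring))
  obtain ⟨s', rfl⟩ := dvd_iff_isRoot.mpr hs0
  obtain ⟨r', rfl⟩ := dvd_iff_isRoot.mpr hr0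
  rw [map_mul] at hs hr
  exact ⟨⟨s', mul_left_cancel₀ hne hs⟩, ⟨r', mul_left_cancel₀ hne hr⟩⟩

/-- If the curve is nonsingular over the roots of `d`, then `d z ∈ k[t] ⊕ k[t] w` implies
`z ∈ k[t] ⊕ k[t] w` for an integral element `z = a + b w`. -/
theorem mem_of_prod_mul_mem_of_nonsingular {t : E} (ht : IsRationalCoordinate k t) {Q P : k[X]}
    (m : Multiset k)
    (hm : ∀ c ∈ m, Q.eval c ≠ 0 ∨ (derivative P ^ 2 + derivative Q ^ 2 * P).eval c ≠ 0) {a b : E}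
    (htr : b * aeval t Q ∈ Algebra.adjoin k {t})
    (hnorm : a ^ 2 + a * (b * aeval t Q) + b ^ 2 * aeval t P ∈ Algebra.adjoin k {t})
    (ha : aeval t (m.map fun c => X - C c).prod * a ∈ Algebra.adjoin k {t})
    (hb : aeval t (m.map fun c => X - C c).prod * b ∈ Algebra.adjoin k {t}) :
    a ∈ Algebra.adjoin k {t} ∧ b ∈ Algebra.adjoin k {t} := by
  induction m using Multiset.induction_on with
  | empty => exact ⟨by simpa using ha, by simpa using hb⟩
  | cons c m ih =>
    rw [Multiset.map_cons, Multiset.prod_cons, map_mul, mul_assoc] at ha hb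
    have he : aeval t (m.map fun c => X - C c).prod ∈ Algebra.adjoin k {t} :=
      mem_adjoin_singleton_iff_exists_aeval.mpr ⟨_, rfl⟩
    generalize aeval t (m.map fun c => X - C c).prod = e at ha hb he ih
    obtain ⟨h1, h2⟩ := mem_of_sub_mul_mem_of_nonsingular ht (hm c (Multiset.mem_cons_self c m))
      (a := e * a) (b := e * b) (by rw [mul_assoc]; exact mul_mem he htr)
      (by
        convert mul_mem (pow_mem he 2) hnorm using 1
        ring) ha hb
    exact ih (fun c' hc' => hm c' (Multiset.mem_cons_of_mem hc')) h1 h2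

end Nonsingular

/-! ### The Čech complex -/

section Rank

variable {k V : Type*} [Field k] [AddCommGroup V] [Module k V]

theorem span_range_mkQ_eq_top {C N : Submodule k V} {n : ℕ} {e : Fin n → V} (he : ∀ i, e i ∈ C)
    (hspan : C ≤ N ⊔ Submodule.span k (Set.range e)) :
    Submodule.span k (Set.range fun i => (N.submoduleOf C).mkQ ⟨e i, he i⟩) = ⊤ := by
  rw [eq_top_iff]
  rintro x -
  obtain ⟨⟨v, hv⟩, rfl⟩ := (N.submoduleOf C).mkQ_surjective x
  obtain ⟨u, hu, s, hs, rfl⟩ := Submodule.mem_sup.mp (hspan hv)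
  obtain ⟨c, rfl⟩ := (Submodule.mem_span_range_iff_exists_fun k).mp hs
  rw [Submodule.mem_span_range_iff_exists_fun]
  refine ⟨c, ?_⟩
  simp only [← map_smul, ← map_sum]
  rw [← sub_eq_zero, ← map_sub, Submodule.mkQ_apply, Submodule.Quotient.mk_eq_zero,
    Submodule.submoduleOf, Submodule.mem_comap]
  simpa using hu

theorem finrank_quotient_submoduleOf_le {C N : Submodule k V} {n : ℕ} {e : Fin n → V}
    (he : ∀ i, e i ∈ C) (hspan : C ≤ N ⊔ Submodule.span k (Set.range e)) :
    Module.finrank k (C ⧸ N.submoduleOf C) ≤ n := by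
  have h := finrank_range_le_card (R := k) fun i => (N.submoduleOf C).mkQ ⟨e i, he i⟩
  rwa [Set.finrank, span_range_mkQ_eq_top he hspan, finrank_top, Fintype.card_fin] at h

theorem finrank_quotient_submoduleOf_eq {C N : Submodule k V} {n : ℕ} {e : Fin n → V}
    (he : ∀ i, e i ∈ C) (hspan : C ≤ N ⊔ Submodule.span k (Set.range e))
    (hind : ∀ c : Fin n → k, ∑ i, c i • e i ∈ N → ∀ i, c i = 0) :
    Module.finrank k (C ⧸ N.submoduleOf C) = n := by
  have hli : LinearIndependent k fun i => (N.submoduleOf C).mkQ ⟨e i, he i⟩ := by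
    rw [Fintype.linearIndependent_iff]
    intro c hc
    apply hind c
    simp only [← map_smul, ← map_sum] at hc
    rw [Submodule.mkQ_apply, Submodule.Quotient.mk_eq_zero, Submodule.submoduleOf,
      Submodule.mem_comap] at hc
    simpa using hc
  rw [Module.finrank_eq_card_basis (Module.Basis.mk hli (span_range_mkQ_eq_top he hspan).ge),
    Fintype.card_fin]

end Rank

section Cech

variable {k E F : Type*} [Field k] [Field E] [CharP E 2] [CommRing F] [Algebra k E]
  [Algebra E F] {x : E} {Q P : k[X]} {w : F}

/-- A function with poles over `0` and `∞` only is, up to an element of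
`k[x, 1/x] ⊕ k[x, 1/x] w`, regular away from `∞`. With `Q = x ^ m Q'` and `Q'` prime to `x`, a
Bézout relation `u x ^ M + v Q' = 1` splits `z` as `u x ^ M z + v Q' z`. -/
theorem exists_isIntegral_add [Nontrivial F] (hx : IsRationalCoordinate k x)
    (h : IsQuadraticGenerator (aeval x Q) (aeval x P) w) (hQ : Q ≠ 0) {z : F}
    (hz : IsIntegral (Algebra.adjoin k {x, x⁻¹}) z) :
    ∃ z' : F, ∃ a b : E, IsIntegral (Algebra.adjoin k {x}) z' ∧ a ∈ Algebra.adjoin k {x, x⁻¹} ∧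
      b ∈ Algebra.adjoin k {x, x⁻¹} ∧ z = z' + (algebraMap E F a + algebraMap E F b * w) := by
  have hmem : ∀ f : k[X], aeval x f ∈ Algebra.adjoin k {x} := fun f =>
    mem_adjoin_singleton_iff_exists_aeval.mpr ⟨f, rfl⟩
  obtain ⟨a, b, rfl⟩ := h.exists_repr z
  obtain ⟨htr, hnorm⟩ := h.trace_mem_and_norm_mem_of_isIntegral
    (fun _ => hx.mem_adjoin_pair_of_isIntegral) hz
  obtain ⟨M₁, hM₁⟩ := exists_pow_mul_mem_adjoin hx.ne_zero htr
  obtain ⟨M₂, hM₂⟩ := exists_pow_mul_mem_adjoin hx.ne_zero hnorm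
  obtain ⟨M, hMM₁, hMM₂⟩ : ∃ M, M₁ ≤ M ∧ M₂ ≤ M := ⟨max M₁ M₂, le_max_left _ _, le_max_right _ _⟩
  have htr' : x ^ M * b * aeval x Q ∈ Algebra.adjoin k {x} := by
    rw [mul_assoc]
    exact hM₁ M hMM₁
  have hnorm' : (x ^ M * a) ^ 2 + x ^ M * a * (x ^ M * b * aeval x Q) +
      (x ^ M * b) ^ 2 * aeval x P ∈ Algebra.adjoin k {x} := by
    convert hM₂ (M + M) (by omega) using 1
    ring
  have hQa := mul_mem_of_norm_mem (fun _ => hx.mem_adjoin_of_isIntegral) (hmem Q) (hmem P) htr'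
    hnorm'
  obtain ⟨Q', hQQ', hQ'⟩ := exists_eq_pow_rootMultiplicity_mul_and_not_dvd Q hQ 0
  rw [C_0, sub_zero] at hQQ' hQ'
  generalize Q.rootMultiplicity 0 = m at hQQ'
  obtain ⟨u, v, huv⟩ := ((irreducible_X.coprime_iff_not_dvd.mpr hQ').pow_left : IsCoprime (X ^ M) Q')
  have huv' := congrArg (aeval x) huv
  simp only [map_add, map_mul, map_pow, aeval_X, map_one] at huv'
  have hQx : aeval x Q = x ^ m * aeval x Q' := by
    rw [hQQ', map_mul, map_pow, aeval_X]
  refine ⟨algebraMap E F (aeval x u * (x ^ M * a)) + algebraMap E F (aeval x u * (x ^ M * b)) * w,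
    aeval x v * (aeval x Q' * a), aeval x v * (aeval x Q' * b), ?_, ?_, ?_, ?_⟩
  · apply h.isIntegral_of_trace_mem_of_norm_mem
    · rw [mul_assoc]
      exact mul_mem (hmem u) htr'
    · convert mul_mem (pow_mem (hmem u) 2) hnorm' using 1
      ring
  · refine mul_mem (adjoin_singleton_le_pair x (hmem v)) ?_
    refine mem_adjoin_pair_of_pow_mul_mem hx.ne_zero (N := m + M) ?_
    convert hQa using 1
    rw [hQx]
    ring
  · refine mul_mem (adjoin_singleton_le_pair x (hmem v)) ?_
    refine mem_adjoin_pair_of_pow_mul_mem hx.ne_zero (N := m + M) ?_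
    convert htr' using 1
    rw [hQx]
    ring
  · have ha : a = aeval x u * (x ^ M * a) + aeval x v * (aeval x Q' * a) := by
      linear_combination (-a) * huv'
    have hb : b = aeval x u * (x ^ M * b) + aeval x v * (aeval x Q' * b) := by
      linear_combination (-b) * huv'
    conv_lhs => rw [ha, hb]
    simp only [map_add]
    ring

theorem isIntegral_algebraMap_mul {S : Subalgebra k E} {Q P s : E}
    (h : IsQuadraticGenerator Q P w) (hQ : Q ∈ S) (hP : P ∈ S) (hs : s ∈ S) :
    IsIntegral S (algebraMap E F s * w) := by
  rw [← zero_add (algebraMap E F s * w), ← map_zero (algebraMap E F)]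
  apply h.isIntegral_of_trace_mem_of_norm_mem
  · exact mul_mem hs hQ
  · rw [zero_pow two_ne_zero, zero_mul, zero_add, zero_add]
    exact mul_mem (pow_mem hs 2) hP

theorem isIntegral_zpow_mul (h : IsQuadraticGenerator (aeval x Q) (aeval x P) w) {i : ℤ}
    (hi : 0 ≤ i) : IsIntegral (Algebra.adjoin k {x}) (algebraMap E F (x ^ i) * w) := by
  obtain ⟨n, rfl⟩ := Int.eq_ofNat_of_zero_le hi
  rw [zpow_natCast]
  exact isIntegral_algebraMap_mul h (mem_adjoin_singleton_iff_exists_aeval.mpr ⟨Q, rfl⟩)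
    (mem_adjoin_singleton_iff_exists_aeval.mpr ⟨P, rfl⟩) (pow_mem_adjoin_singleton x n)

/-- The function `v = w / x ^ (n + 1)` satisfies the equation in the chart at infinity. -/
theorem isQuadraticGenerator_infinity (hx : x ≠ 0)
    (h : IsQuadraticGenerator (aeval x Q) (aeval x P) w) {n : ℕ} (hQn : Q.natDegree ≤ n + 1)
    (hPn : P.natDegree ≤ 2 * n + 2) :
    IsQuadraticGenerator (aeval x⁻¹ (Q.reflect (n + 1))) (aeval x⁻¹ (P.reflect (2 * n + 2)))
      (algebraMap E F (x ^ (n + 1))⁻¹ * w) := by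
  have h' := h.add_div 0 (pow_ne_zero (n + 1) hx)
  rw [map_zero, add_zero, zero_pow two_ne_zero, zero_mul, add_zero, add_zero, ← pow_mul] at h'
  rw [aeval_inv_reflect hx hQn, aeval_inv_reflect hx hPn]
  rwa [show (n + 1) * 2 = 2 * n + 2 by ring] at h'

theorem isIntegral_inv_zpow_mul (hx : IsRationalCoordinate k x)
    (h : IsQuadraticGenerator (aeval x Q) (aeval x P) w) {n : ℕ} (hQn : Q.natDegree ≤ n + 1)
    (hPn : P.natDegree ≤ 2 * n + 2) {i : ℤ} (hi : i ≤ -(n + 1)) :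
    IsIntegral (Algebra.adjoin k {x⁻¹}) (algebraMap E F (x ^ i) * w) := by
  have hv := isIntegral_zpow_mul (isQuadraticGenerator_infinity hx.ne_zero h hQn hPn)
    (i := -(n + 1) - i) (by omega)
  convert hv using 1
  rw [← mul_assoc, ← map_mul, inv_zpow', ← zpow_natCast, ← zpow_neg, ← zpow_add₀ hx.ne_zero]
  congr 3
  push_cast
  ring

/-- If the affine curve has no singular point, then `k[x] ⊕ k[x] w` is integrally closed. -/
theorem mem_adjoin_of_isIntegral_of_nonsingular [CharP k 2] [IsAlgClosed k] [Nontrivial F]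
    (hx : IsRationalCoordinate k x)
    (h : IsQuadraticGenerator (aeval x Q) (aeval x P) w) (hQ : Q.Monic)
    (hns : ∀ c, Q.eval c ≠ 0 ∨ (derivative P ^ 2 + derivative Q ^ 2 * P).eval c ≠ 0) {a b : E}
    (hz : IsIntegral (Algebra.adjoin k {x}) (algebraMap E F a + algebraMap E F b * w)) :
    a ∈ Algebra.adjoin k {x} ∧ b ∈ Algebra.adjoin k {x} := by
  have hmem : ∀ f : k[X], aeval x f ∈ Algebra.adjoin k {x} := fun f =>
    mem_adjoin_singleton_iff_exists_aeval.mpr ⟨f, rfl⟩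
  obtain ⟨htr, hnorm⟩ := h.trace_mem_and_norm_mem_of_isIntegral
    (fun _ => hx.mem_adjoin_of_isIntegral) hz
  have hprod : (Q.roots.map fun c => X - C c).prod = Q :=
    ((IsAlgClosed.splits Q).eq_prod_roots_of_monic hQ).symm
  refine mem_of_prod_mul_mem_of_nonsingular hx Q.roots (fun c _ => hns c) htr hnorm ?_ ?_
  · rw [hprod]
    exact mul_mem_of_norm_mem (fun _ => hx.mem_adjoin_of_isIntegral) (hmem Q) (hmem P) htr hnorm
  · rw [hprod, mul_comm]
    exact htr

/-- If the curve has no singular point at all, then the functions regular away from `x = 0` are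
those of `k[1/x] ⊕ k[1/x] w / x ^ (n + 1)`. -/
theorem exists_eq_zpow_mul_of_isIntegral_of_nonsingular [CharP k 2] [IsAlgClosed k] [Nontrivial F]
    (hx : IsRationalCoordinate k x)
    (h : IsQuadraticGenerator (aeval x Q) (aeval x P) w) (hQ : Q.Monic)
    (hns : ∀ c, Q.eval c ≠ 0 ∨ (derivative P ^ 2 + derivative Q ^ 2 * P).eval c ≠ 0)
    {n : ℕ} (hQn : Q.natDegree ≤ n + 1) (hPn : P.natDegree ≤ 2 * n + 2)
    (hinf : (Q.reflect (n + 1)).eval 0 ≠ 0 ∨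
      (derivative (P.reflect (2 * n + 2)) ^ 2 +
        derivative (Q.reflect (n + 1)) ^ 2 * P.reflect (2 * n + 2)).eval 0 ≠ 0) {a b : E}
    (hz : IsIntegral (Algebra.adjoin k {x⁻¹}) (algebraMap E F a + algebraMap E F b * w)) :
    ∃ r ∈ Algebra.adjoin k {x⁻¹}, b = x ^ (-(n + 1) : ℤ) * r := by
  have hx0 := hx.ne_zero
  have hinv := isQuadraticGenerator_infinity hx0 h hQn hPn
  have hzv : algebraMap E F a + algebraMap E F b * w = algebraMap E F a +
      algebraMap E F (b * x ^ (n + 1)) * (algebraMap E F (x ^ (n + 1))⁻¹ * w) := by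
    rw [← mul_assoc, ← map_mul, mul_assoc b, mul_inv_cancel₀ (pow_ne_zero _ hx0), mul_one]
  -- An element integral over `k[1/x]` is integral over `k[x, 1/x]`, so its coordinates are
  -- Laurent polynomials by the affine case.
  obtain ⟨htr, hnorm⟩ := h.trace_mem_and_norm_mem_of_isIntegral
    (fun _ => hx.inv.mem_adjoin_of_isIntegral) hz
  obtain ⟨M₁, hM₁⟩ := exists_pow_mul_mem_adjoin hx0 (adjoin_inv_le_pair x htr)
  obtain ⟨M₂, hM₂⟩ := exists_pow_mul_mem_adjoin hx0 (adjoin_inv_le_pair x hnorm)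
  obtain ⟨M, hMM₁, hMM₂⟩ : ∃ M, M₁ ≤ M ∧ M₂ ≤ M := ⟨max M₁ M₂, le_max_left _ _, le_max_right _ _⟩
  obtain ⟨ha, hb⟩ := mem_adjoin_of_isIntegral_of_nonsingular hx h hQ hns
    (h.isIntegral_of_trace_mem_of_norm_mem (a := x ^ M * a) (b := x ^ M * b)
      (by rw [mul_assoc]; exact hM₁ M hMM₁)
      (by
        convert hM₂ (M + M) (by omega) using 1
        ring))
  have hb' : b * x ^ (n + 1) ∈ Algebra.adjoin k {x, x⁻¹} := by
    refine mul_mem (mem_adjoin_pair_of_pow_mul_mem hx0 hb) ?_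
    exact adjoin_singleton_le_pair x (pow_mem_adjoin_singleton x _)
  obtain ⟨N₁, hN₁⟩ := exists_inv_pow_mul_mem_adjoin hx0 (mem_adjoin_pair_of_pow_mul_mem hx0 ha)
  obtain ⟨N₂, hN₂⟩ := exists_inv_pow_mul_mem_adjoin hx0 hb'
  rw [hzv] at hz
  obtain ⟨htr', hnorm'⟩ := hinv.trace_mem_and_norm_mem_of_isIntegral
    (fun _ => hx.inv.mem_adjoin_of_isIntegral) hz
  have hprod : aeval x⁻¹ ((Multiset.replicate (max N₁ N₂) (0 : k)).map fun c => X - C c).prod =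
      x⁻¹ ^ max N₁ N₂ := by
    rw [Multiset.map_replicate, Multiset.prod_replicate, C_0, sub_zero, map_pow, aeval_X]
  obtain ⟨-, hr⟩ := mem_of_prod_mul_mem_of_nonsingular hx.inv
    (Multiset.replicate (max N₁ N₂) (0 : k))
    (fun c hc => by rwa [Multiset.eq_of_mem_replicate hc]) htr' hnorm'
    (by rw [hprod]; exact hN₁ _ (le_max_left _ _))
    (by rw [hprod]; exact hN₂ _ (le_max_right _ _))
  refine ⟨_, hr, ?_⟩
  rw [← zpow_natCast, mul_left_comm, ← zpow_add₀ hx0, Nat.cast_add, Nat.cast_one, neg_add_cancel,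
    zpow_zero, mul_one]

end Cech

/-! ### The genus of a quadratic extension of `k(x)` -/

section GenusComputation

variable {k F : Type*} [Field k] [CommRing F] [Algebra k F] [Algebra (RatFunc k) F]

/-- The function `w / x ^ (i + 1)`. For `0 ≤ i < n` these functions generate the cokernel of the
Čech complex of `y ^ 2 + Q y = P` when `deg Q ≤ n + 1` and `deg P ≤ 2 n + 2`. -/
noncomputable def cechGenerator (w : F) (n : ℕ) (i : Fin n) : F :=
  algebraMap (RatFunc k) F (RatFunc.X ^ (-(i + 1) : ℤ)) * w

theorem isIntegral_algebraMap_of_mem {k F : Type*} [Field k] [CommRing F]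
    [Algebra (RatFunc k) F] {S : Subalgebra k (RatFunc k)} {r : RatFunc k} (hr : r ∈ S) :
    IsIntegral S (algebraMap (RatFunc k) F r) :=
  isIntegral_algebraMap (R := S) (A := F) (x := ⟨r, hr⟩)

variable [IsScalarTower k (RatFunc k) F]

theorem mem_regularAwayFromInfinity {z : F} : z ∈ regularAwayFromInfinity k F ↔
    IsIntegral (Algebra.adjoin k {(RatFunc.X : RatFunc k)}) z :=
  Iff.rfl

theorem mem_regularAwayFromZero {z : F} : z ∈ regularAwayFromZero k F ↔
    IsIntegral (Algebra.adjoin k {(RatFunc.X : RatFunc k)⁻¹}) z :=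
  Iff.rfl

theorem mem_regularAwayFromZeroAndInfinity {z : F} : z ∈ regularAwayFromZeroAndInfinity k F ↔
    IsIntegral (Algebra.adjoin k {(RatFunc.X : RatFunc k), (RatFunc.X : RatFunc k)⁻¹}) z :=
  Iff.rfl

variable [CharP k 2] {Q P : k[X]} {w : F} {n : ℕ}

theorem charP_ratFunc : CharP (RatFunc k) 2 :=
  charP_of_injective_algebraMap' k 2

theorem cechGenerator_mem
    (h : IsQuadraticGenerator (aeval (RatFunc.X : RatFunc k) Q) (aeval RatFunc.X P) w)
    (i : Fin n) : cechGenerator (k := k) w n i ∈ regularAwayFromZeroAndInfinity k F := by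
  have := charP_ratFunc (k := k)
  have hmem : ∀ f : k[X], aeval (RatFunc.X : RatFunc k) f ∈
      Algebra.adjoin k {(RatFunc.X : RatFunc k), (RatFunc.X : RatFunc k)⁻¹} := fun f =>
    adjoin_singleton_le_pair _ (mem_adjoin_singleton_iff_exists_aeval.mpr ⟨f, rfl⟩)
  exact mem_regularAwayFromZeroAndInfinity.mpr
    (isIntegral_algebraMap_mul h (hmem Q) (hmem P) (zpow_mem_adjoin_pair _ _))

theorem regularAwayFromZeroAndInfinity_le [Nontrivial F]
    (h : IsQuadraticGenerator (aeval (RatFunc.X : RatFunc k) Q) (aeval RatFunc.X P) w)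
    (hQ : Q ≠ 0) (hQn : Q.natDegree ≤ n + 1) (hPn : P.natDegree ≤ 2 * n + 2) :
    regularAwayFromZeroAndInfinity k F ≤
      (regularAwayFromInfinity k F ⊔ regularAwayFromZero k F) ⊔
        Submodule.span k (Set.range (cechGenerator (k := k) w n)) := by
  have := charP_ratFunc (k := k)
  have hX := isRationalCoordinate_ratFuncX (k := k)
  intro z hz
  obtain ⟨z', a, b, hz', ha, hb, rfl⟩ :=
    exists_isIntegral_add hX h hQ (mem_regularAwayFromZeroAndInfinity.mp hz)
  set A := regularAwayFromInfinity k F with hA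
  set B := regularAwayFromZero k F with hB
  set M := (A ⊔ B) ⊔ Submodule.span k (Set.range (cechGenerator (k := k) w n)) with hM
  have hAM : A ≤ M := le_sup_left.trans le_sup_left
  have hBM : B ≤ M := le_sup_right.trans le_sup_left
  refine add_mem (hAM (mem_regularAwayFromInfinity.mpr hz')) (add_mem ?_ ?_)
  · let φ : RatFunc k →ₗ[k] F := (Algebra.linearMap (RatFunc k) F).restrictScalars k
    refine mem_of_forall_zpow_mem (M := M.comap φ) hX.ne_zero (fun i => ?_) ha
    change algebraMap (RatFunc k) F (RatFunc.X ^ i) ∈ M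
    obtain ⟨j, rfl | rfl⟩ := i.eq_nat_or_neg
    · refine hAM (mem_regularAwayFromInfinity.mpr (isIntegral_algebraMap_of_mem ?_))
      rw [zpow_natCast]
      exact pow_mem_adjoin_singleton _ j
    · refine hBM (mem_regularAwayFromZero.mpr (isIntegral_algebraMap_of_mem ?_))
      rw [zpow_neg, zpow_natCast, ← inv_pow]
      exact pow_mem_adjoin_singleton _ j
  · let φ : RatFunc k →ₗ[k] F := ((LinearMap.mulRight (RatFunc k) w).comp
      (Algebra.linearMap (RatFunc k) F)).restrictScalars k
    refine mem_of_forall_zpow_mem (M := M.comap φ) hX.ne_zero (fun i => ?_) hb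
    change algebraMap (RatFunc k) F (RatFunc.X ^ i) * w ∈ M
    by_cases h0 : 0 ≤ i
    · exact hAM (mem_regularAwayFromInfinity.mpr (isIntegral_zpow_mul h h0))
    by_cases hn : i ≤ -(n + 1)
    · exact hBM (mem_regularAwayFromZero.mpr (isIntegral_inv_zpow_mul hX h hQn hPn hn))
    · refine le_sup_right (a := A ⊔ B) (Submodule.subset_span ⟨⟨(-i - 1).toNat, by omega⟩, ?_⟩)
      rw [cechGenerator]
      congr 3
      simp only
      omega

/-- The genus is at most the arithmetic genus `n` of the equation `w ^ 2 + Q w = P`. -/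
theorem functionFieldGenus_le [Nontrivial F]
    (h : IsQuadraticGenerator (aeval (RatFunc.X : RatFunc k) Q) (aeval RatFunc.X P) w)
    (hQ : Q ≠ 0) (hQn : Q.natDegree ≤ n + 1) (hPn : P.natDegree ≤ 2 * n + 2) :
    functionFieldGenus k F ≤ n :=
  finrank_quotient_submoduleOf_le (cechGenerator_mem h)
    (regularAwayFromZeroAndInfinity_le h hQ hQn hPn)

/-- The genus equals the arithmetic genus `n` if the equation is nonsingular: the coefficient of
`w` in a regular function is a combination of `x ^ i` with `i ≥ 0` on one chart and `i ≤ -(n + 1)`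
on the other, so the functions `w / x ^ (i + 1)`, `i < n`, are independent modulo both. -/
theorem functionFieldGenus_eq [IsAlgClosed k] [Nontrivial F]
    (h : IsQuadraticGenerator (aeval (RatFunc.X : RatFunc k) Q) (aeval RatFunc.X P) w)
    (hQ : Q.Monic) (hQn : Q.natDegree ≤ n + 1) (hPn : P.natDegree ≤ 2 * n + 2)
    (hns : ∀ c, Q.eval c ≠ 0 ∨ (derivative P ^ 2 + derivative Q ^ 2 * P).eval c ≠ 0)
    (hinf : (Q.reflect (n + 1)).eval 0 ≠ 0 ∨
      (derivative (P.reflect (2 * n + 2)) ^ 2 +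
        derivative (Q.reflect (n + 1)) ^ 2 * P.reflect (2 * n + 2)).eval 0 ≠ 0) :
    functionFieldGenus k F = n := by
  have := charP_ratFunc (k := k)
  have hX := isRationalCoordinate_ratFuncX (k := k)
  refine finrank_quotient_submoduleOf_eq (cechGenerator_mem h)
    (regularAwayFromZeroAndInfinity_le h hQ.ne_zero hQn hPn) fun c hc => ?_
  obtain ⟨z₁, hz₁, z₂, hz₂, hsum⟩ := Submodule.mem_sup.mp hc
  obtain ⟨a₁, b₁, rfl⟩ := h.exists_repr z₁
  obtain ⟨a₂, b₂, rfl⟩ := h.exists_repr z₂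
  obtain ⟨-, hb₁⟩ := mem_adjoin_of_isIntegral_of_nonsingular hX h hQ hns
    (mem_regularAwayFromInfinity.mp hz₁)
  obtain ⟨r, hr, rfl⟩ := exists_eq_zpow_mul_of_isIntegral_of_nonsingular hX h hQ hns hQn hPn hinf
    (mem_regularAwayFromZero.mp hz₂)
  let f : ℤ → RatFunc k := fun i => RatFunc.X ^ i
  have hf : LinearIndependent k f := linearIndependent_zpow hX.transcendental
  have hcoef : b₁ + RatFunc.X ^ (-(n + 1) : ℤ) * r = ∑ i : Fin n, c i • f (-(i + 1)) := by
    refine h.snd_eq (a := a₁ + a₂) (c := 0) ?_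
    have hs : algebraMap (RatFunc k) F (∑ i : Fin n, c i • f (-(i + 1))) * w =
        ∑ i, c i • cechGenerator (k := k) w n i := by
      rw [map_sum, Finset.sum_mul]
      refine Finset.sum_congr rfl fun i _ => ?_
      rw [Algebra.algebraMap_eq_smul_one, smul_assoc, ← Algebra.algebraMap_eq_smul_one,
        smul_mul_assoc]
      rfl
    rw [hs, ← hsum]
    simp only [map_add, map_zero]
    ring
  have hleft : ∑ i : Fin n, c i • f (-(i + 1)) ∈
      Submodule.span k (f '' ({i | 0 ≤ i} ∪ {i | i ≤ -(n + 1)})) := by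
    rw [← hcoef, Set.image_union, Submodule.span_union]
    exact Submodule.add_mem_sup (adjoin_singleton_le_span hb₁)
      (zpow_mul_adjoin_inv_le_span hX.ne_zero _ hr)
  have hright : ∑ i : Fin n, c i • f (-(i + 1)) ∈
      Submodule.span k (f '' {i | -(n + 1) < i ∧ i < 0}) := by
    refine Submodule.sum_mem _ fun i _ => Submodule.smul_mem _ _ (Submodule.subset_span ?_)
    refine ⟨_, ⟨?_, ?_⟩, rfl⟩ <;> have := i.isLt <;> omega
  have hdisj : Disjoint ({i : ℤ | 0 ≤ i} ∪ {i | i ≤ -(n + 1)})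
      {i : ℤ | -(n + 1) < i ∧ i < 0} := by
    rw [Set.disjoint_left]
    rintro i hi ⟨h1, h2⟩
    rcases hi with hi | hi <;> simp only [Set.mem_ofPred_eq] at hi <;> omega
  have hzero := Submodule.disjoint_def.mp (hf.disjoint_span_image hdisj) _ hleft hright
  have hinj : Function.Injective fun i : Fin n => (-(i + 1) : ℤ) := by
    intro i j hij
    simp only at hij
    exact Fin.ext (by omega)
  exact Fintype.linearIndependent_iff.mp (hf.comp _ hinj) c hzero

end GenusComputation

/-! ### Singular points lower the genus -/

section Singular

variable {k F : Type*} [Field k] [CharP k 2] [IsAlgClosed k] [CommRing F] [Nontrivial F]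
  [Algebra k F] [Algebra (RatFunc k) F] [IsScalarTower k (RatFunc k) F]
  {Q P : k[X]} {w : F} {n : ℕ}

theorem exists_eq_sub_sq_mul {R : Type*} [CommRing R] {f : R[X]} {c : R} (h0 : f.eval c = 0)
    (h1 : (derivative f).eval c = 0) : ∃ f₁, f = (X - C c) ^ 2 * f₁ := by
  obtain ⟨f₀, rfl⟩ := dvd_iff_isRoot.mpr h0
  have h2 : f₀.eval c = 0 := by simpa [derivative_mul] using h1
  obtain ⟨f₁, rfl⟩ := dvd_iff_isRoot.mpr h2
  exact ⟨f₁, by ring⟩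

/-- At a singular point `(c, s)` the function `(w + s) / (x - c)` is regular, and it satisfies an
equation of arithmetic genus one less. -/
theorem functionFieldGenus_le_of_singular
    (h : IsQuadraticGenerator (aeval (RatFunc.X : RatFunc k) Q) (aeval RatFunc.X P) w)
    (hQ : Q ≠ 0) (hQn : Q.natDegree ≤ n + 2) (hPn : P.natDegree ≤ 2 * n + 4) {c : k}
    (hQc : Q.eval c = 0) (hc : (derivative P ^ 2 + derivative Q ^ 2 * P).eval c = 0) :
    functionFieldGenus k F ≤ n := by
  have := charP_ratFunc (k := k)
  have hX := isRationalCoordinate_ratFuncX (k := k)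
  obtain ⟨s, hs⟩ := IsAlgClosed.exists_pow_nat_eq (P.eval c) two_pos
  have hd : aeval (RatFunc.X : RatFunc k) (X - C c) ≠ 0 := by
    rw [Ne, map_eq_zero_iff _ hX.aeval_injective]
    exact X_sub_C_ne_zero c
  obtain ⟨Q₁, hQ₁⟩ := dvd_iff_isRoot.mpr hQc
  -- The constant term `P + s ^ 2 + s Q` of the equation of `w + s` vanishes doubly at `c`.
  have h0 : (P + C s ^ 2 + C s * Q).eval c = 0 := by
    simp only [eval_add, eval_pow, eval_C, eval_mul, hQc, mul_zero, hs,
      CharTwo.add_self_eq_zero]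
  have h1 : (derivative (P + C s ^ 2 + C s * Q)).eval c = 0 := by
    rw [← C_pow, derivative_add, derivative_add, derivative_C, derivative_C_mul, add_zero, eval_add,
      eval_mul, eval_C]
    rw [eval_add, eval_mul, eval_pow, eval_pow, ← hs] at hc
    refine pow_eq_zero_iff two_ne_zero |>.mp ?_
    rw [CharTwo.add_sq, ← hc]
    ring
  obtain ⟨P₁, hP₁⟩ := exists_eq_sub_sq_mul h0 h1
  have h' := h.add_div (aeval RatFunc.X (C s)) hd
  have e1 : aeval (RatFunc.X : RatFunc k) Q / aeval RatFunc.X (X - C c) =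
      aeval RatFunc.X Q₁ := by
    rw [hQ₁, map_mul, mul_div_cancel_left₀ _ hd]
  have e2 : (aeval (RatFunc.X : RatFunc k) P + aeval RatFunc.X (C s) ^ 2 +
      aeval RatFunc.X (C s) * aeval RatFunc.X Q) / aeval RatFunc.X (X - C c) ^ 2 =
      aeval RatFunc.X P₁ := by
    rw [← map_pow (aeval _) (C s), ← map_mul, ← map_add, ← map_add, hP₁, map_mul, map_pow,
      mul_div_cancel_left₀ _ (pow_ne_zero 2 hd)]
  rw [e1, e2] at h'
  have hQ₁0 : Q₁ ≠ 0 := by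
    rintro rfl
    exact hQ (by rw [hQ₁, mul_zero])
  refine functionFieldGenus_le h' hQ₁0 ?_ ?_
  · rw [hQ₁, (monic_X_sub_C c).natDegree_mul' hQ₁0, natDegree_X_sub_C] at hQn
    omega
  · by_cases hP₁0 : P₁ = 0
    · rw [hP₁0, natDegree_zero]
      omega
    have hdeg : (P + C s ^ 2 + C s * Q).natDegree ≤ 2 * n + 4 := by
      refine natDegree_add_le_of_degree_le (natDegree_add_le_of_degree_le hPn ?_) ?_
      · rw [← C_pow, natDegree_C]
        omega
      · exact (natDegree_C_mul_le _ _).trans (by omega)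
    rw [hP₁, ((monic_X_sub_C c).pow 2).natDegree_mul' hP₁0, (monic_X_sub_C c).natDegree_pow,
      natDegree_X_sub_C] at hdeg
    omega

/-- If there is a singular point at infinity, then for a suitable `s` the equation of
`w + s x ^ (n + 2)` has smaller degrees. -/
theorem functionFieldGenus_le_of_singular_infinity
    (h : IsQuadraticGenerator (aeval (RatFunc.X : RatFunc k) Q) (aeval RatFunc.X P) w)
    (hQ : Q ≠ 0) (hQn : Q.natDegree ≤ n + 1) (hPn : P.natDegree ≤ 2 * n + 4)
    (hinf : P.coeff (2 * n + 3) ^ 2 = P.coeff (2 * n + 4) * Q.coeff (n + 1) ^ 2) :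
    functionFieldGenus k F ≤ n := by
  have := charP_ratFunc (k := k)
  obtain ⟨s, hs⟩ := IsAlgClosed.exists_pow_nat_eq (P.coeff (2 * n + 4)) two_pos
  have h' := h.add_div (aeval RatFunc.X (C s * X ^ (n + 2))) one_ne_zero
  rw [div_one, one_pow, div_one, ← map_pow, ← map_mul, ← map_add, ← map_add] at h'
  -- The coefficients of degree `2 n + 3` and `2 n + 4` cancel: the first is
  -- `a_{2n+3} + s b_{n+1}`, whose square is zero by assumption, the second `a_{2n+4} + s ^ 2`.
  refine functionFieldGenus_le h' hQ hQn (natDegree_le_iff_coeff_eq_zero.mpr fun i hi => ?_)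
  have e1 : ((C s * X ^ (n + 2)) ^ 2 : k[X]) = C (s ^ 2) * X ^ (2 * n + 4) := by
    rw [C_pow]
    ring
  have e2 : C s * X ^ (n + 2) * Q = C s * (Q * X ^ (n + 2)) := by ring
  rw [e1, e2, coeff_add, coeff_add, coeff_C_mul, coeff_C_mul, coeff_X_pow, coeff_mul_X_pow',
    if_pos (by omega : n + 2 ≤ i), hs]
  obtain rfl | hi := (Nat.succ_le_of_lt hi).eq_or_lt
  · rw [if_neg (by omega), mul_zero, add_zero, show (2 * n + 2).succ - (n + 2) = n + 1 by omega]
    refine pow_eq_zero_iff two_ne_zero |>.mp ?_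
    rw [CharTwo.add_sq, mul_pow, hs, ← hinf]
    exact CharTwo.add_self_eq_zero _
  have hQi : Q.coeff (i - (n + 2)) = 0 := coeff_eq_zero_of_natDegree_lt (by omega)
  rw [hQi, mul_zero, add_zero]
  obtain rfl | hi := (Nat.succ_le_of_lt hi).eq_or_lt
  · rw [if_pos rfl, mul_one]
    exact CharTwo.add_self_eq_zero _
  · rw [if_neg (by omega), mul_zero, add_zero]
    exact coeff_eq_zero_of_natDegree_lt (by omega)

end Singular

/-! ### The function field -/

section FunctionField

theorem isQuadraticGenerator_root {E : Type*} [Field E] [CharP E 2] (Q P : E) :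
    IsQuadraticGenerator Q P (AdjoinRoot.root (X ^ 2 + C Q * X - C P)) := by
  set f : E[X] := X ^ 2 + C Q * X - C P with hf
  have hmonic : f.Monic := by
    rw [hf]
    monicity!
  have hdeg : f.natDegree = 2 := by
    rw [hf]
    compute_degree!
  have hroot : AdjoinRoot.root f ^ 2 + algebraMap E (AdjoinRoot f) Q * AdjoinRoot.root f =
      algebraMap E (AdjoinRoot f) P := by
    have h := AdjoinRoot.eval₂_root f
    conv at h => enter [1, 3]; rw [hf]
    simp only [eval₂_sub, eval₂_add, eval₂_mul, eval₂_pow, eval₂_X, eval₂_C] at h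
    exact sub_eq_zero.mp h
  have hmk : ∀ a b : E, AdjoinRoot.mk f (C b * X + C a) =
      algebraMap E (AdjoinRoot f) a + algebraMap E (AdjoinRoot f) b * AdjoinRoot.root f := by
    intro a b
    rw [map_add, map_mul, AdjoinRoot.mk_X, AdjoinRoot.mk_C, AdjoinRoot.mk_C, add_comm]
    rfl
  refine ⟨hroot, fun z => ?_, fun a b hab => ?_, ?_⟩
  · obtain ⟨p, rfl⟩ := AdjoinRoot.mk_surjective z
    have hlt := natDegree_modByMonic_lt p hmonic (by
      intro h1
      rw [h1, natDegree_one] at hdeg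
      omega)
    obtain ⟨b, a, hba⟩ := exists_eq_X_add_C_of_natDegree_le_one
      (show (p %ₘ f).natDegree ≤ 1 by omega)
    refine ⟨a, b, ?_⟩
    rw [← hmk, ← hba, AdjoinRoot.mk_eq_mk]
    exact ⟨p /ₘ f, sub_eq_of_eq_add' (modByMonic_add_div p f).symm⟩
  · rw [← hmk, AdjoinRoot.mk_eq_zero] at hab
    have h0 := eq_zero_of_dvd_of_natDegree_lt hab (natDegree_linear_le.trans_lt (by omega))
    simpa using congrArg (fun p => p.coeff 1) h0
  · have h2 : algebraMap E (AdjoinRoot f) 2 = 0 := by rw [CharTwo.two_eq_zero, map_zero]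
    rw [map_ofNat] at h2
    refine ⟨AdjoinRoot.liftAlgHom f (Algebra.ofId E (AdjoinRoot f))
      (AdjoinRoot.root f + algebraMap E (AdjoinRoot f) Q) ?_, AdjoinRoot.liftAlgHom_root ..⟩
    conv_lhs => enter [3]; rw [hf]
    simp only [eval₂_sub, eval₂_add, eval₂_mul, eval₂_pow, eval₂_X, eval₂_C]
    change (_ ^ 2 + algebraMap E (AdjoinRoot f) Q * _ - algebraMap E (AdjoinRoot f) P) = 0
    linear_combination hroot + (algebraMap E (AdjoinRoot f) Q * AdjoinRoot.root f +
      algebraMap E (AdjoinRoot f) Q ^ 2) * h2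

/-- A reducible equation `(y + s) (y + s + Q) = 0` is singular wherever `Q` vanishes. -/
theorem irreducible_of_nonsingular {k : Type*} [Field k] [CharP k 2] {Q P : k[X]} {c : k}
    (hQc : Q.eval c = 0) (hc : (derivative P ^ 2 + derivative Q ^ 2 * P).eval c ≠ 0) :
    Irreducible (X ^ 2 + C (aeval (RatFunc.X : RatFunc k) Q) * X -
      C (aeval (RatFunc.X : RatFunc k) P)) := by
  have hX := isRationalCoordinate_ratFuncX (k := k)
  have hmem : ∀ f : k[X], aeval (RatFunc.X : RatFunc k) f ∈ Algebra.adjoin k {RatFunc.X} :=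
    fun f => mem_adjoin_singleton_iff_exists_aeval.mpr ⟨f, rfl⟩
  set f : (RatFunc k)[X] := X ^ 2 + C (aeval (RatFunc.X : RatFunc k) Q) * X -
      C (aeval (RatFunc.X : RatFunc k) P) with hf
  have hmonic : f.Monic := by
    rw [hf]
    monicity!
  have hdeg : f.natDegree = 2 := by
    rw [hf]
    compute_degree!
  rw [hmonic.irreducible_iff_roots_eq_zero_of_degree_le_three hdeg.ge (by omega),
    Multiset.eq_zero_iff_forall_notMem]
  intro r hr
  have hr0 := isRoot_of_mem_roots hr
  rw [IsRoot.def, hf] at hr0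
  simp only [eval_sub, eval_add, eval_mul, eval_pow, eval_X, eval_C] at hr0
  have hint : IsIntegral (Algebra.adjoin k {(RatFunc.X : RatFunc k)}) r := by
    refine ⟨X ^ 2 + C ⟨_, hmem Q⟩ * X - C ⟨_, hmem P⟩, by monicity!, ?_⟩
    simp only [eval₂_sub, eval₂_add, eval₂_mul, eval₂_pow, eval₂_X, eval₂_C]
    exact hr0
  obtain ⟨s, rfl⟩ := mem_adjoin_singleton_iff_exists_aeval.mp (hX.mem_adjoin_of_isIntegral hint)
  have hP : P = s ^ 2 + Q * s := by
    apply hX.aeval_injective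
    rw [map_add, map_pow, map_mul]
    exact (sub_eq_zero.mp hr0).symm
  apply hc
  have h2 : (2 : k) = 0 := CharTwo.two_eq_zero
  rw [hP]
  simp only [derivative_add, derivative_mul, derivative_pow, eval_add, eval_mul, eval_pow, hQc,
    eval_C, Nat.cast_ofNat, h2]
  linear_combination (eval c (derivative Q) ^ 2 * eval c s ^ 2) * h2

end FunctionField

theorem mainTheorem3 {K : Type*} [Field K] [CharP K 2] (g : ℕ) (hg : 1 ≤ g) (q p : K[X])
    (hq_monic : q.Monic) (hq_nonconst : 0 < q.natDegree) (hq_deg : q.natDegree ≤ g + 1)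
    (hp_deg : p.natDegree ≤ 2 * g + 2)
    (hlow : 2 * g + 1 ≤ max (2 * q.natDegree) p.natDegree)
    (hhigh : max (2 * q.natDegree) p.natDegree ≤ 2 * g + 2) :
    (DefinesCurveOfGenus g q p ↔
      IsCoprime q (derivative p ^ 2 + derivative q ^ 2 * p) ∧
        (q.natDegree = g + 1 ∨
          p.coeff (2 * g + 1) ^ 2 ≠ p.coeff (2 * g + 2) * q.coeff g ^ 2)) ∧
    (IsSmoothAffine q p ↔ IsCoprime q (derivative p ^ 2 + derivative q ^ 2 * p)) ∧
    (IsSmoothAtInfinity g q p ↔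
      (q.natDegree = g + 1 ∨
        p.coeff (2 * g + 1) ^ 2 ≠ p.coeff (2 * g + 2) * q.coeff g ^ 2)) := by
  refine ⟨?_, isSmoothAffine_iff q p, isSmoothAtInfinity_iff hq_monic hq_deg⟩
  have hchar : CharP (AlgebraicClosure K) 2 := charP_of_injective_algebraMap' K 2
  have := charP_ratFunc (k := AlgebraicClosure K)
  have hinj := (algebraMap K (AlgebraicClosure K)).injective
  set Q := q.map (algebraMap K (AlgebraicClosure K)) with hQ
  set P := p.map (algebraMap K (AlgebraicClosure K)) with hP
  have hQ_monic : Q.Monic := hq_monic.map _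
  have hQ_natDegree : Q.natDegree = q.natDegree := natDegree_map _
  have hP_natDegree : P.natDegree = p.natDegree := natDegree_map _
  have hcoprime : IsCoprime q (derivative p ^ 2 + derivative q ^ 2 * p) ↔
      ∀ c, Q.eval c ≠ 0 ∨ (derivative P ^ 2 + derivative Q ^ 2 * P).eval c ≠ 0 := by
    rw [isCoprime_iff_aeval_ne_zero_of_isAlgClosed K (AlgebraicClosure K)]
    simp only [← eval_map_algebraMap, Polynomial.map_add, Polynomial.map_mul, Polynomial.map_pow,
      derivative_map, hQ, hP]
  have hinfinity : (q.natDegree = g + 1 ∨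
      p.coeff (2 * g + 1) ^ 2 ≠ p.coeff (2 * g + 2) * q.coeff g ^ 2) ↔
      (Q.natDegree = g + 1 ∨
        P.coeff (2 * g + 1) ^ 2 ≠ P.coeff (2 * g + 2) * Q.coeff g ^ 2) := by
    rw [hQ_natDegree, hQ, hP, coeff_map, coeff_map, coeff_map, ← map_pow, ← map_pow, ← map_mul,
      hinj.ne_iff]
  have hf : genericFibrePolynomial q p = X ^ 2 + C (aeval (RatFunc.X) Q) * X -
      C (aeval (RatFunc.X) P) := by
    rw [genericFibrePolynomial, RatFunc.aeval_X_left_eq_algebraMap,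
      RatFunc.aeval_X_left_eq_algebraMap]
  have hgen := isQuadraticGenerator_root (aeval (RatFunc.X : RatFunc (AlgebraicClosure K)) Q)
    (aeval RatFunc.X P)
  rw [← hf] at hgen
  rw [hcoprime, hinfinity, DefinesCurveOfGenus]
  constructor
  · rintro ⟨hirr, hgenus⟩
    have : Nontrivial (AdjoinRoot (genericFibrePolynomial q p)) :=
      AdjoinRoot.nontrivial _ (degree_pos_of_irreducible hirr).ne'
    -- A singular point makes the genus at most `n = g - 1`.
    obtain ⟨n, rfl⟩ := Nat.exists_eq_add_of_le' hg
    constructor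
    · by_contra! hc
      obtain ⟨c, hQc, hc⟩ := hc
      have := functionFieldGenus_le_of_singular (n := n) hgen hQ_monic.ne_zero (by omega)
        (by omega) hQc hc
      omega
    · by_contra! hc
      have := functionFieldGenus_le_of_singular_infinity (n := n) hgen hQ_monic.ne_zero (by omega)
        (by omega) hc.2
      omega
  · rintro ⟨hns, hinf⟩
    -- The polynomial `Q` is not constant, so it has a zero `c`.
    obtain ⟨c, hc⟩ := IsAlgClosed.exists_root Q (by
      rw [degree_eq_natDegree hQ_monic.ne_zero, hQ_natDegree]
      exact_mod_cast hq_nonconst.ne')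
    have hirr := irreducible_of_nonsingular hc ((hns c).resolve_left (not_not.mpr hc))
    rw [← hf] at hirr
    have : Nontrivial (AdjoinRoot (genericFibrePolynomial q p)) :=
      AdjoinRoot.nontrivial _ (degree_pos_of_irreducible hirr).ne'
    refine ⟨hirr, functionFieldGenus_eq hgen hQ_monic (by omega) (by omega) hns ?_⟩
    rw [← coeff_zero_eq_eval_zero, ← coeff_zero_eq_eval_zero]
    exact (reflect_nonsingular_iff hQ_monic (by omega)).mpr hinf
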